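/- Let $k$ be a field of characteristic different from $2$ and let $d\ge 0$. A superspace is a finite dimensional $k$-vector space $M=M_0\oplus M_1$ graded by $\mathbb{Z}/2$. The symmetric group $\mathfrak{S}_d$ acts on the right on $M^{\otimes d}$ so that, for homogeneous $v_1,\dots,v_d$, the transposition $(i\ \,i{+}1)$ sends $v_1\otimes\cdots\otimes v_d$ to $(-1)^{|v_i||v_{i+1}|}\,v_1\otimes\cdots\otimes v_{i+1}\otimes v_i\otimes\cdots\otimes v_d$. Let $\mathsf{\Gamma}^d$ be the category whose objects are the superspaces and whose morphisms $M\to N$ are the elements of the superspace $\Gamma^d\mathrm{Hom}(M,N)\simeq\mathrm{Hom}_{k\mathfrak{S}_d}(M^{\otimes d},N^{\otimes d})$, composed as linear maps. Let $\mathsf{Pol}^{\mathsf I}_d$ be the category whose objects are the $k$-linear, parity-preserving functors $T$ from $\mathsf{\Gamma}^d$ to the category of superspaces and all linear maps. A morphism $\eta:S\to T$ of $\mathsf{Pol}^{\mathsf I}_d$ is a family of linear maps $\eta(M)=\eta_0(M)+\eta_1(M):S(M)\to T(M)$ with $\eta_\varepsilon(M)$ homogeneous of degree $\varepsilon$ and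 $T(f)\circ\eta_\varepsilon(M)=(-1)^{\varepsilon|f|}\,\eta_\varepsilon(N)\circ S(f)$ for all homogeneous $f\in\Gamma^d\mathrm{Hom}(M,N)$. Let $\lambda$ be a partition with $|\lambda|=d$ and conjugate $\lambda'$. For a superspace $M$ put $S^\lambda(M)=S^{\lambda_1}(M)\otimes S^{\lambda_2}(M)\otimes\cdots$, where $S^n(M)=(M^{\otimes n})_{\mathfrak{S}_n}$, and $\Gamma_\Pi^{\lambda'}(M)=\Gamma_\Pi^{\lambda'_1}(M)\otimes\Gamma_\Pi^{\lambda'_2}(M)\otimes\cdots$, where $\Gamma_\Pi^n(M)=\mathrm{Hom}_{k\mathfrak{S}_n}((k^{0|1})^{\otimes n},M^{\otimes n})$. Let $\Delta_\Pi:\Gamma_\Pi^{\lambda'}(M)\to M^{\otimes d}$ be the canonical embedding, given by evaluation at a generator of the line $(k^{0|1})^{\otimes d}$, and let $m:M^{\otimes d}\to S^\lambda(M)$ be the multiplication. Let $\sigma_\lambda\in\mathfrak{S}_d$ be the permutation that sends the number of each cell of the Young diagram of $\lambda$ in the row-by-row numbering to its number in the column-by-column numbering. The Schur superfunctor $\widehat{S}_\lambda\in\mathsf{Pol}^{\mathsf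 I}_d$ is defined by $$\widehat{S}_\lambda(M)=\mathrm{Im}\Big(\Gamma_\Pi^{\lambda'}(M)\xrightarrow{\ \Delta_\Pi\ }M^{\otimes d}\xrightarrow{\ \sigma_\lambda\ }M^{\otimes d}\xrightarrow{\ m\ }S^\lambda(M)\Big),$$ with the action of $\mathsf{\Gamma}^d$ inherited from $S^\lambda$. Proposition. For every partition $\lambda$ with $|\lambda|=d$, the Schur superfunctor $\widehat{S}_\lambda$ is an indecomposable object of $\mathsf{Pol}^{\mathsf I}_d$: it is nonzero, and whenever $\widehat{S}_\lambda\cong S\oplus T$ with $S,T\in\mathsf{Pol}^{\mathsf I}_d$, either $S=0$ or $T=0$. -/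

import Mathlib

open CategoryTheory CategoryTheory.Limits
open scoped TensorProduct

universe u

namespace SuperPoly

/-! ## Superspaces -/

/-- A finite dimensional vector superspace `M = M₀ ⊕ M₁` over `k`. -/
structure SVec (k : Type u) [Field k] where
  carrier : Type u
  [addCommGroup : AddCommGroup carrier]
  [module : Module k carrier]
  [finite : Module.Finite k carrier]
  part : ZMod 2 → Submodule k carrier
  isCompl : IsCompl (part 0) (part 1)

attribute [instance] SVec.addCommGroup SVec.module SVec.finite

instance (k : Type u) [Field k] : CoeSort (SVec k) (Type u) := ⟨SVec.carrier⟩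

theorem zmod_two_cases (e : ZMod 2) : e = 0 ∨ e = 1 := by
  revert e; decide

variable {k : Type u} [Field k]

theorem SVec.isCompl_part (M : SVec k) (e : ZMod 2) : IsCompl (M.part e) (M.part (e + 1)) := by
  rcases zmod_two_cases e with rfl | rfl
  · simpa using M.isCompl
  · have h : (1 + 1 : ZMod 2) = 0 := by decide
    rw [h]; exact M.isCompl.symm

/-- The projection of `M = M₀ ⊕ M₁` onto its component `M_e`, as an endomorphism of `M`. -/
noncomputable def SVec.proj (M : SVec k) (e : ZMod 2) : M →ₗ[k] M :=
  (M.part e).projection (M.part (e + 1)) (M.isCompl_part e)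

theorem SVec.proj_mem (M : SVec k) (e : ZMod 2) (x : M) : M.proj e x ∈ M.part e :=
  Submodule.projection_apply_mem _ _

theorem SVec.proj_of_mem (M : SVec k) (e : ZMod 2) {x : M} (hx : x ∈ M.part e) :
    M.proj e x = x :=
  Submodule.projection_apply_of_mem_left _ hx

theorem SVec.proj_of_mem_ne (M : SVec k) {e e' : ZMod 2} (h : e ≠ e') {x : M}
    (hx : x ∈ M.part e') : M.proj e x = 0 := by
  have h' : e' = e + 1 := by
    clear hx
    revert e e'
    decide
  subst h'
  exact Submodule.projection_apply_of_mem_right _ hx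

theorem SVec.proj_add (M : SVec k) (x : M) : M.proj 0 x + M.proj 1 x = x := by
  have hx : x ∈ M.part 0 ⊔ M.part 1 := by rw [M.isCompl.sup_eq_top]; trivial
  obtain ⟨a, ha, b, hb, rfl⟩ := Submodule.mem_sup.1 hx
  simp [map_add, M.proj_of_mem 0 ha, M.proj_of_mem 1 hb,
    M.proj_of_mem_ne (by decide : (0 : ZMod 2) ≠ 1) hb,
    M.proj_of_mem_ne (by decide : (1 : ZMod 2) ≠ 0) ha]

/-- `Hom(M, N)_e`: the linear maps with `f (M_δ) ⊆ N_{e+δ}`. -/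
def homPart (M N : SVec k) (e : ZMod 2) : Submodule k (M →ₗ[k] N) where
  carrier := {f | ∀ δ : ZMod 2, ∀ x ∈ M.part δ, f x ∈ N.part (e + δ)}
  add_mem' hf hg δ x hx := (N.part _).add_mem (hf δ x hx) (hg δ x hx)
  zero_mem' _ _ _ := (N.part _).zero_mem
  smul_mem' c _ hf δ x hx := (N.part _).smul_mem c (hf δ x hx)

theorem comp_mem_homPart {M N P : SVec k} {e e' : ZMod 2} {g : N →ₗ[k] P} {f : M →ₗ[k] N}
    (hg : g ∈ homPart N P e) (hf : f ∈ homPart M N e') : g ∘ₗ f ∈ homPart M P (e + e') :=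
  fun δ x hx => by
    have := hg _ _ (hf δ x hx)
    rwa [← add_assoc] at this

theorem id_mem_homPart (M : SVec k) : LinearMap.id ∈ homPart M M 0 := fun δ x hx => by
  simpa using hx

theorem proj_comm {M N : SVec k} {f : M →ₗ[k] N} (hf : f ∈ homPart M N 0) (e : ZMod 2) (x : M) :
    N.proj e (f x) = f (M.proj e x) := by
  have h : ∀ δ, ∀ y ∈ M.part δ, N.proj e (f y) = f (M.proj e y) := by
    intro δ y hy
    have h1 : f y ∈ N.part δ := by simpa using hf δ y hy
    by_cases hd : e = δ
    · subst hd; rw [N.proj_of_mem e h1, M.proj_of_mem e hy]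
    · rw [N.proj_of_mem_ne hd h1, M.proj_of_mem_ne hd hy, map_zero]
  rw [← M.proj_add x]
  simp only [map_add]
  rw [h 0 _ (M.proj_mem 0 x), h 1 _ (M.proj_mem 1 x)]

/-- The purely odd line `k^{0|1}`. -/
def oddLine (k : Type u) [Field k] : SVec k where
  carrier := k
  part e := if e = 1 then ⊤ else ⊥
  isCompl := by simpa using isCompl_bot_top

/-! ## Tensor powers and the signed action of the symmetric group -/

/-- The degree `e` component of `M^{⊗d}`: the span of the `v₁ ⊗ ⋯ ⊗ v_d` with all `vᵢ`
homogeneous and total degree `e`. -/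
def tpowPart (M : SVec k) (d : ℕ) (e : ZMod 2) : Submodule k (⨂[k] _ : Fin d, M) :=
  Submodule.span k {x | ∃ (a : Fin d → ZMod 2) (v : Fin d → M),
    ∑ i, a i = e ∧ (∀ i, v i ∈ M.part (a i)) ∧ PiTensorProduct.tprod k v = x}

theorem sum_map_proj (M : SVec k) (d : ℕ) (x : ⨂[k] _ : Fin d, M) :
    ∑ a : Fin d → ZMod 2, PiTensorProduct.map (fun i => M.proj (a i)) x = x := by
  induction x using PiTensorProduct.induction_on with
  | smul_tprod r v =>
    simp only [map_smul, PiTensorProduct.map_tprod, ← Finset.smul_sum]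
    congr 1
    rw [← MultilinearMap.map_sum (PiTensorProduct.tprod k) (fun i (e : ZMod 2) => M.proj e (v i))]
    congr 1
    funext i
    exact (Fin.sum_univ_two (fun e : Fin 2 => M.proj e (v i))).trans (M.proj_add (v i))
  | add x y hx hy =>
    simp only [map_add, Finset.sum_add_distrib, hx, hy]

theorem map_proj_of_homogeneous (M : SVec k) {d : ℕ} (a b : Fin d → ZMod 2) (v : Fin d → M)
    (hv : ∀ i, v i ∈ M.part (b i)) :
    PiTensorProduct.map (fun i => M.proj (a i)) (PiTensorProduct.tprod k v) =
      if a = b then PiTensorProduct.tprod k v else 0 := by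
  rw [PiTensorProduct.map_tprod]
  split_ifs with h
  · subst h
    congr 1
    funext i
    exact M.proj_of_mem _ (hv i)
  · obtain ⟨i, hi⟩ := Function.ne_iff.1 h
    exact MultilinearMap.map_coord_zero _ i (M.proj_of_mem_ne hi (hv i))

theorem map_proj_mem (M : SVec k) {d : ℕ} (a : Fin d → ZMod 2) (x : ⨂[k] _ : Fin d, M) :
    PiTensorProduct.map (fun i => M.proj (a i)) x ∈ tpowPart M d (∑ i, a i) := by
  induction x using PiTensorProduct.induction_on with
  | smul_tprod r v =>
    rw [map_smul, PiTensorProduct.map_tprod]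
    exact Submodule.smul_mem _ _
      (Submodule.subset_span ⟨a, _, rfl, fun i => M.proj_mem _ _, rfl⟩)
  | add x y hx hy => rw [map_add]; exact Submodule.add_mem _ hx hy

theorem isCompl_tpowPart (M : SVec k) (d : ℕ) : IsCompl (tpowPart M d 0) (tpowPart M d 1) := by
  let P : (⨂[k] _ : Fin d, M) →ₗ[k] (⨂[k] _ : Fin d, M) :=
    ∑ a : Fin d → ZMod 2, if ∑ i, a i = 0 then PiTensorProduct.map (fun i => M.proj (a i)) else 0
  have hP : ∀ (b : Fin d → ZMod 2) (v : Fin d → M), (∀ i, v i ∈ M.part (b i)) →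
      P (PiTensorProduct.tprod k v) = if ∑ i, b i = 0 then PiTensorProduct.tprod k v else 0 := by
    intro b v hv
    simp only [P, LinearMap.sum_apply]
    rw [Finset.sum_eq_single b]
    · split_ifs
      · rw [map_proj_of_homogeneous M b b v hv, if_pos rfl]
      · rfl
    · intro a _ hab
      split_ifs
      · rw [map_proj_of_homogeneous M a b v hv, if_neg hab]
      · rfl
    · simp
  have h0 : ∀ x ∈ tpowPart M d 0, P x = x := by
    intro x hx
    induction hx using Submodule.span_induction with
    | mem x h => obtain ⟨a, v, ha, hv, rfl⟩ := h; rw [hP a v hv, if_pos ha]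
    | zero => simp
    | add x y _ _ hx hy => rw [map_add, hx, hy]
    | smul c x _ hx => rw [map_smul, hx]
  have h1 : ∀ x ∈ tpowPart M d 1, P x = 0 := by
    intro x hx
    induction hx using Submodule.span_induction with
    | mem x h =>
      obtain ⟨a, v, ha, hv, rfl⟩ := h
      rw [hP a v hv, if_neg (by rw [ha]; decide)]
    | zero => simp
    | add x y _ _ hx hy => rw [map_add, hx, hy, add_zero]
    | smul c x _ hx => rw [map_smul, hx, smul_zero]
  constructor
  · rw [Submodule.disjoint_def]
    intro x hx0 hx1
    rw [← h0 x hx0, h1 x hx1]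
  · rw [codisjoint_iff, eq_top_iff]
    intro x _
    rw [← sum_map_proj M d x]
    refine Submodule.sum_mem _ fun a _ => ?_
    have := map_proj_mem M a x
    rcases zmod_two_cases (∑ i, a i) with h | h
    · rw [h] at this; exact Submodule.mem_sup_left this
    · rw [h] at this; exact Submodule.mem_sup_right this

/-- The superspace `M^{⊗d}`. -/
noncomputable abbrev SVec.tpow (M : SVec k) (d : ℕ) : SVec k where
  carrier := ⨂[k] _ : Fin d, M
  part := tpowPart M d
  isCompl := isCompl_tpowPart M d

/-- `sgn(a, σ) = ∏ (-1)^{a_s a_t}` over the pairs `s < t` with `σ⁻¹ s > σ⁻¹ t`. -/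
def superSign (k : Type u) [Field k] {d : ℕ} (a : Fin d → ZMod 2) (σ : Equiv.Perm (Fin d)) : k :=
  ∏ p : Fin d × Fin d,
    if p.1 < p.2 ∧ σ.symm p.2 < σ.symm p.1 then (-1 : k) ^ (a p.1 * a p.2).val else 1

/-- The right action `x ↦ x.σ` of `σ ∈ 𝔖_d` on `M^{⊗d}`: for homogeneous `vᵢ` of degree `aᵢ`,
`(v₁ ⊗ ⋯ ⊗ v_d).σ = sgn(a, σ) v_{σ1} ⊗ ⋯ ⊗ v_{σd}` (see `superAct_tprod`). -/
noncomputable def superAct (M : SVec k) {d : ℕ} (σ : Equiv.Perm (Fin d)) :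
    (⨂[k] _ : Fin d, M) →ₗ[k] (⨂[k] _ : Fin d, M) :=
  ∑ a : Fin d → ZMod 2, superSign k a σ •
    ((PiTensorProduct.reindex k (fun _ : Fin d => (M : Type u)) σ.symm).toLinearMap ∘ₗ
      PiTensorProduct.map (fun i => M.proj (a i)))

theorem superAct_tprod (M : SVec k) {d : ℕ} (σ : Equiv.Perm (Fin d)) (a : Fin d → ZMod 2)
    (v : Fin d → M) (hv : ∀ i, v i ∈ M.part (a i)) :
    superAct M σ (PiTensorProduct.tprod k v) =
      superSign k a σ • PiTensorProduct.tprod k (fun i => v (σ i)) := by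
  unfold superAct
  rw [LinearMap.sum_apply, Finset.sum_eq_single a]
  · rw [LinearMap.smul_apply, LinearMap.comp_apply, map_proj_of_homogeneous M a a v hv, if_pos rfl]
    congr 1
    exact PiTensorProduct.reindex_tprod _ _
  · intro b _ hb
    rw [LinearMap.smul_apply, LinearMap.comp_apply, map_proj_of_homogeneous M b a v hv,
      if_neg hb, map_zero, smul_zero]
  · simp

theorem superAct_mem_homPart (M : SVec k) {d : ℕ} (σ : Equiv.Perm (Fin d)) :
    superAct M σ ∈ homPart (M.tpow d) (M.tpow d) 0 := by
  intro δ x hx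
  rw [zero_add]
  change x ∈ tpowPart M d δ at hx
  change superAct M σ x ∈ tpowPart M d δ
  induction hx using Submodule.span_induction with
  | mem x h =>
    obtain ⟨a, v, ha, hv, rfl⟩ := h
    rw [superAct_tprod M σ a v hv]
    refine Submodule.smul_mem _ _ (Submodule.subset_span
      ⟨fun i => a (σ i), fun i => v (σ i), ?_, fun i => hv _, rfl⟩)
    rw [← ha]
    exact Equiv.sum_comp σ a
  | zero => rw [map_zero]; exact Submodule.zero_mem _
  | add x y _ _ hx hy => rw [map_add]; exact Submodule.add_mem _ hx hy
  | smul c x _ hx => rw [map_smul]; exact Submodule.smul_mem _ _ hx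

/-- The linear maps `M^{⊗d} → N^{⊗d}` commuting with the signed action of the subgroup `H`
of `𝔖_d`. -/
def equivHom {d : ℕ} (H : Subgroup (Equiv.Perm (Fin d))) (M N : SVec k) :
    Submodule k (M.tpow d →ₗ[k] N.tpow d) where
  carrier := {f | ∀ σ ∈ H, f ∘ₗ superAct M σ = superAct N σ ∘ₗ f}
  add_mem' hf hg σ hσ := by
    rw [LinearMap.add_comp, LinearMap.comp_add, hf σ hσ, hg σ hσ]
  zero_mem' σ _ := by rw [LinearMap.zero_comp, LinearMap.comp_zero]
  smul_mem' c _ hf σ hσ := by rw [LinearMap.smul_comp, LinearMap.comp_smul, hf σ hσ]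

theorem equivHom_mono {d : ℕ} {H K : Subgroup (Equiv.Perm (Fin d))} (h : H ≤ K) (M N : SVec k) :
    equivHom K M N ≤ equivHom H M N := fun _ hf σ hσ => hf σ (h hσ)

theorem comp_mem_equivHom {d : ℕ} {H : Subgroup (Equiv.Perm (Fin d))} {M N P : SVec k}
    {g : N.tpow d →ₗ[k] P.tpow d} {f : M.tpow d →ₗ[k] N.tpow d}
    (hg : g ∈ equivHom H N P) (hf : f ∈ equivHom H M N) : g ∘ₗ f ∈ equivHom H M P := by
  intro σ hσ
  rw [LinearMap.comp_assoc, hf σ hσ, ← LinearMap.comp_assoc, hg σ hσ, LinearMap.comp_assoc]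

/-! ## The category `Γ^d` and polynomial superfunctors of type I -/

/-- The space of morphisms `M → N` of the category `Γ^d_M`, whose objects are the finite
dimensional superspaces: `Γ^d Hom(M, N) = Hom_{k𝔖_d}(M^{⊗d}, N^{⊗d})`. -/
abbrev GammaHom (d : ℕ) (M N : SVec k) : Type u :=
  equivHom (⊤ : Subgroup (Equiv.Perm (Fin d))) M N

/-- The identity morphism of `M` in `Γ^d_M`. -/
def GammaHom.id (d : ℕ) (M : SVec k) : GammaHom d M M :=
  ⟨LinearMap.id, fun σ _ => by rw [LinearMap.id_comp, LinearMap.comp_id]⟩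

/-- The composition of morphisms `f : M → N` and `g : N → P` of `Γ^d_M`. -/
def GammaHom.comp {d : ℕ} {M N P : SVec k} (g : GammaHom d N P) (f : GammaHom d M N) :
    GammaHom d M P :=
  ⟨g.1 ∘ₗ f.1, comp_mem_equivHom g.2 f.2⟩

/-- `f` is homogeneous of degree `e` in the superspace of morphisms `M → N` of `Γ^d_M`. -/
def GammaHom.IsHomogeneous {d : ℕ} {M N : SVec k} (f : GammaHom d M N) (e : ZMod 2) : Prop :=
  f.1 ∈ homPart (M.tpow d) (N.tpow d) e

/-- An object of `Pol^I_d`: an even `k`-linear functor from `Γ^d_M` to the category `svec` of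
finite dimensional superspaces and all linear maps. -/
structure Pol (k : Type u) [Field k] (d : ℕ) where
  obj : SVec k → SVec k
  map {M N : SVec k} : GammaHom d M N →ₗ[k] (obj M →ₗ[k] obj N)
  map_id : ∀ M : SVec k, map (GammaHom.id d M) = LinearMap.id
  map_comp : ∀ {M N P : SVec k} (g : GammaHom d N P) (f : GammaHom d M N),
    map (g.comp f) = map g ∘ₗ map f
  map_even : ∀ {M N : SVec k} (f : GammaHom d M N) (e : ZMod 2), f.IsHomogeneous e →
    map f ∈ homPart (obj M) (obj N) e

variable {d : ℕ}

/-- A morphism `η = η₀ + η₁ : S → T` of `Pol^I_d`, that is, an `Svec`-enriched natural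
transformation: `η_e(M)` is homogeneous of degree `e`, and
`T(f) ∘ η_e(M) = (-1)^{e|f|} η_e(N) ∘ S(f)` for homogeneous `f : M → N`. -/
@[ext]
structure Pol.Hom (S T : Pol k d) where
  app : ZMod 2 → ∀ M : SVec k, S.obj M →ₗ[k] T.obj M
  homogeneous : ∀ (e : ZMod 2) (M : SVec k), app e M ∈ homPart (S.obj M) (T.obj M) e
  natural : ∀ (e δ : ZMod 2) {M N : SVec k} (f : GammaHom d M N), f.IsHomogeneous δ →
    T.map f ∘ₗ app e M = (-1 : k) ^ (δ * e).val • (app e N ∘ₗ S.map f)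

namespace Pol

theorem Hom.natural_apply {S T : Pol k d} (η : Hom S T) (e δ : ZMod 2) {M N : SVec k}
    (f : GammaHom d M N) (hf : f.IsHomogeneous δ) (x : S.obj M) :
    T.map f (η.app e M x) = (-1 : k) ^ (δ * e).val • η.app e N (S.map f x) :=
  LinearMap.congr_fun (η.natural e δ f hf) x

theorem sign_mul (δ a b : ZMod 2) :
    (-1 : k) ^ (δ * a).val * (-1 : k) ^ (δ * b).val = (-1 : k) ^ (δ * (a + b)).val := by
  have h : ∀ δ a b : ZMod 2,
      ((δ * a).val + (δ * b).val) % 2 = (δ * (a + b)).val % 2 := by decide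
  rw [← pow_add, neg_one_pow_eq_pow_mod_two, h, ← neg_one_pow_eq_pow_mod_two]

/-- The identity transformation: it is even. -/
def Hom.id (S : Pol k d) : Hom S S where
  app e M := if e = 0 then LinearMap.id else 0
  homogeneous e M := by
    split_ifs with h
    · subst h; exact id_mem_homPart _
    · exact Submodule.zero_mem _
  natural e δ M N f _ := by
    split_ifs with h
    · subst h; simp
    · simp

/-- The composition: `(θη)_e = θ₀ η_e + θ₁ η_{e+1}`. -/
def Hom.comp {S T U : Pol k d} (η : Hom S T) (θ : Hom T U) : Hom S U where
  app e M := ∑ a : ZMod 2, θ.app a M ∘ₗ η.app (e - a) M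
  homogeneous e M := Submodule.sum_mem _ fun a _ => by
    have := comp_mem_homPart (θ.homogeneous a M) (η.homogeneous (e - a) M)
    rwa [add_sub_cancel] at this
  natural e δ M N f hf := by
    ext x
    simp only [LinearMap.comp_apply, LinearMap.smul_apply, LinearMap.sum_apply, map_sum,
      Finset.smul_sum]
    refine Finset.sum_congr rfl fun a _ => ?_
    rw [θ.natural_apply a δ f hf, η.natural_apply (e - a) δ f hf, map_smul, smul_smul, sign_mul,
      add_sub_cancel]

theorem sum_zmod_two {A : Type*} [AddCommMonoid A] (g : ZMod 2 → A) : ∑ a, g a = g 0 + g 1 :=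
  Fin.sum_univ_two (f := g)

instance : Category (Pol k d) where
  Hom := Hom
  id := Hom.id
  comp := Hom.comp
  id_comp η := by
    ext e M x
    rcases zmod_two_cases e with rfl | rfl <;> simp [Hom.comp, Hom.id, sum_zmod_two]
  comp_id η := by
    ext e M x
    rcases zmod_two_cases e with rfl | rfl <;> simp [Hom.comp, Hom.id, sum_zmod_two]
  assoc η θ ζ := by
    have h : (0 - 1 : ZMod 2) = 1 := by decide
    ext e M x
    rcases zmod_two_cases e with rfl | rfl <;> simp [Hom.comp, sum_zmod_two, h] <;> abel

theorem hom_ext {S T : Pol k d} {η θ : S ⟶ T} (h : ∀ e M x, Hom.app η e M x = Hom.app θ e M x) :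
    η = θ :=
  Hom.ext (funext fun e => funext fun M => LinearMap.ext fun x => h e M x)

instance (S T : Pol k d) : Zero (Hom S T) where
  zero :=
    { app := fun _ _ => 0
      homogeneous := fun _ _ => Submodule.zero_mem _
      natural := fun _ _ _ _ _ _ => by simp }

instance (S T : Pol k d) : Add (Hom S T) where
  add η θ :=
    { app := fun e M => η.app e M + θ.app e M
      homogeneous := fun e M => Submodule.add_mem _ (η.homogeneous e M) (θ.homogeneous e M)
      natural := fun e δ _ _ f hf => by
        rw [LinearMap.comp_add, LinearMap.add_comp, smul_add, η.natural e δ f hf,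
          θ.natural e δ f hf] }

instance (S T : Pol k d) : Neg (Hom S T) where
  neg η :=
    { app := fun e M => -η.app e M
      homogeneous := fun e M => Submodule.neg_mem _ (η.homogeneous e M)
      natural := fun e δ _ _ f hf => by
        rw [LinearMap.comp_neg, LinearMap.neg_comp, smul_neg, η.natural e δ f hf] }

instance (S T : Pol k d) : AddCommGroup (Hom S T) where
  add_assoc η θ ζ := Hom.ext (funext fun _ => funext fun _ => add_assoc _ _ _)
  zero_add η := Hom.ext (funext fun _ => funext fun _ => zero_add _)
  add_zero η := Hom.ext (funext fun _ => funext fun _ => add_zero _)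
  add_comm η θ := Hom.ext (funext fun _ => funext fun _ => add_comm _ _)
  neg_add_cancel η := Hom.ext (funext fun _ => funext fun _ => neg_add_cancel _)
  nsmul := nsmulRec
  zsmul := zsmulRec

theorem add_app {S T : Pol k d} (η θ : Hom S T) (e : ZMod 2) (M : SVec k) :
    (η + θ).app e M = η.app e M + θ.app e M := rfl

theorem zero_app {S T : Pol k d} (e : ZMod 2) (M : SVec k) :
    (0 : Hom S T).app e M = 0 := rfl

theorem add_comp_app {S T U : Pol k d} (η η' : Hom S T) (θ : Hom T U) (e : ZMod 2) (M : SVec k)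
    (x : S.obj M) : (Hom.comp (η + η') θ).app e M x =
      (Hom.comp η θ + Hom.comp η' θ).app e M x := by
  simp [Hom.comp, add_app, sum_zmod_two]
  abel

theorem comp_add_app {S T U : Pol k d} (η : Hom S T) (θ θ' : Hom T U) (e : ZMod 2) (M : SVec k)
    (x : S.obj M) : (Hom.comp η (θ + θ')).app e M x =
      (Hom.comp η θ + Hom.comp η θ').app e M x := by
  simp [Hom.comp, add_app, sum_zmod_two]
  abel

instance : Preadditive (Pol k d) where
  homGroup S T := inferInstanceAs (AddCommGroup (Hom S T))
  add_comp S T U η η' θ := by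
    refine hom_ext fun e M x => ?_
    change (Hom.comp (Add.add (α := Hom S T) η η') θ).app e M x = (Hom.comp η θ + Hom.comp η' θ).app e M x
    exact add_comp_app η η' θ e M x
  comp_add S T U η θ θ' := by
    refine hom_ext fun e M x => ?_
    change (Hom.comp η (Add.add (α := Hom T U) θ θ')).app e M x = (Hom.comp η θ + Hom.comp η θ').app e M x
    exact comp_add_app η θ θ' e M x

end Pol

/-- The direct sum of superspaces. -/
abbrev SVec.sum (M N : SVec k) : SVec k where
  carrier := M × N
  part e := (M.part e).prod (N.part e)
  isCompl := by
    constructor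
    · rw [Submodule.disjoint_def]
      rintro ⟨x, y⟩ ⟨hx0, hy0⟩ ⟨hx1, hy1⟩
      exact Prod.ext (Submodule.disjoint_def.1 M.isCompl.disjoint x hx0 hx1)
        (Submodule.disjoint_def.1 N.isCompl.disjoint y hy0 hy1)
    · rw [codisjoint_iff, eq_top_iff]
      rintro ⟨x, y⟩ _
      refine Submodule.mem_sup.2 ⟨(M.proj 0 x, N.proj 0 y), ⟨M.proj_mem 0 x, N.proj_mem 0 y⟩,
        (M.proj 1 x, N.proj 1 y), ⟨M.proj_mem 1 x, N.proj_mem 1 y⟩, ?_⟩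
      exact Prod.ext (M.proj_add x) (N.proj_add y)

namespace Pol

/-- The direct sum of polynomial superfunctors, formed objectwise. -/
abbrev sum (S T : Pol k d) : Pol k d where
  obj M := (S.obj M).sum (T.obj M)
  map {M N} :=
    { toFun := fun f => LinearMap.prodMap (S.map f) (T.map f)
      map_add' := fun f g => by rw [map_add, map_add]; rfl
      map_smul' := fun c f => by rw [map_smul, map_smul]; rfl }
  map_id M := by
    change LinearMap.prodMap _ _ = _
    rw [S.map_id, T.map_id]
    rfl
  map_comp g f := by
    change LinearMap.prodMap _ _ = LinearMap.prodMap _ _ ∘ₗ LinearMap.prodMap _ _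
    rw [S.map_comp, T.map_comp]
    rfl
  map_even f e hf δ x hx := ⟨S.map_even f e hf δ _ hx.1, T.map_even f e hf δ _ hx.2⟩

/-- A natural family of even maps, as a morphism of `Pol^I_d`. -/
def Hom.ofEven {S T : Pol k d} (η : ∀ M : SVec k, S.obj M →ₗ[k] T.obj M)
    (h : ∀ M, η M ∈ homPart (S.obj M) (T.obj M) 0)
    (hη : ∀ (M N : SVec k) (f : GammaHom d M N), T.map f ∘ₗ η M = η N ∘ₗ S.map f) : Hom S T where
  app e M := if e = 0 then η M else 0
  homogeneous e M := by
    split_ifs with he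
    · subst he; exact h M
    · exact Submodule.zero_mem _
  natural e δ M N f _ := by
    split_ifs with he
    · subst he; simp [hη]
    · simp

theorem ofEven_comp_ofEven {S T U : Pol k d} {η : ∀ M : SVec k, S.obj M →ₗ[k] T.obj M}
    {h : ∀ M, η M ∈ homPart (S.obj M) (T.obj M) 0}
    {hη : ∀ (M N : SVec k) (f : GammaHom d M N), T.map f ∘ₗ η M = η N ∘ₗ S.map f}
    {θ : ∀ M : SVec k, T.obj M →ₗ[k] U.obj M}
    {h' : ∀ M, θ M ∈ homPart (T.obj M) (U.obj M) 0}
    {hθ : ∀ (M N : SVec k) (f : GammaHom d M N), U.map f ∘ₗ θ M = θ N ∘ₗ T.map f}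
    (e : ZMod 2) (M : SVec k) (x : S.obj M) :
    (Hom.comp (Hom.ofEven η h hη) (Hom.ofEven θ h' hθ)).app e M x =
      if e = 0 then θ M (η M x) else 0 := by
  rcases zmod_two_cases e with rfl | rfl <;> simp [Hom.comp, Hom.ofEven, sum_zmod_two]

theorem id_app (S : Pol k d) (e : ZMod 2) (M : SVec k) (x : S.obj M) :
    (Hom.id S).app e M x = if e = 0 then x else 0 := by
  rcases zmod_two_cases e with rfl | rfl <;> simp [Hom.id]

/-- The projections and inclusions of the objectwise direct sum. -/
def fstHom (S T : Pol k d) : Hom (sum S T) S :=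
  Hom.ofEven (S := sum S T) (fun M => LinearMap.fst k (S.obj M) (T.obj M))
    (fun M δ x hx => by rw [zero_add]; exact hx.1) (fun _ _ f => rfl)

def sndHom (S T : Pol k d) : Hom (sum S T) T :=
  Hom.ofEven (S := sum S T) (fun M => LinearMap.snd k (S.obj M) (T.obj M))
    (fun M δ x hx => by rw [zero_add]; exact hx.2) (fun _ _ f => rfl)

def inlHom (S T : Pol k d) : Hom S (sum S T) :=
  Hom.ofEven (T := sum S T) (fun M => LinearMap.inl k (S.obj M) (T.obj M))
    (fun M δ x hx => by rw [zero_add]; exact ⟨hx, Submodule.zero_mem _⟩)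
    (fun _ _ f => LinearMap.ext fun x => Prod.ext rfl (map_zero (T.map f)))

def inrHom (S T : Pol k d) : Hom T (sum S T) :=
  Hom.ofEven (T := sum S T) (fun M => LinearMap.inr k (S.obj M) (T.obj M))
    (fun M δ x hx => by rw [zero_add]; exact ⟨Submodule.zero_mem _, hx⟩)
    (fun _ _ f => LinearMap.ext fun x => Prod.ext (map_zero (S.map f)) rfl)

/-- The biproduct diagram on the objectwise direct sum. -/
def bicone (S T : Pol k d) : BinaryBicone S T where
  pt := sum S T
  fst := fstHom S T
  snd := sndHom S T
  inl := inlHom S T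
  inr := inrHom S T
  inl_fst := by
    refine hom_ext fun e M x => ?_
    refine (ofEven_comp_ofEven e M x).trans ((id_app _ e M x).trans ?_).symm
    split_ifs <;> rfl
  inl_snd := by
    refine hom_ext fun e M x => ?_
    refine (ofEven_comp_ofEven e M x).trans ?_
    split_ifs <;> rfl
  inr_fst := by
    refine hom_ext fun e M x => ?_
    refine (ofEven_comp_ofEven e M x).trans ?_
    split_ifs <;> rfl
  inr_snd := by
    refine hom_ext fun e M x => ?_
    refine (ofEven_comp_ofEven e M x).trans ((id_app _ e M x).trans ?_).symm
    split_ifs <;> rfl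

theorem bicone_total (S T : Pol k d) (e : ZMod 2) (M : SVec k) (x : (sum S T).obj M) :
    (Hom.comp (fstHom S T) (inlHom S T)).app e M x +
      (Hom.comp (sndHom S T) (inrHom S T)).app e M x = (Hom.id (sum S T)).app e M x := by
  have h1 : (Hom.comp (fstHom S T) (inlHom S T)).app e M x = if e = 0 then (x.1, 0) else 0 :=
    ofEven_comp_ofEven e M x
  have h2 : (Hom.comp (sndHom S T) (inrHom S T)).app e M x = if e = 0 then (0, x.2) else 0 :=
    ofEven_comp_ofEven e M x
  rw [id_app, h1, h2]
  split_ifs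
  · exact Prod.ext (add_zero _) (zero_add _)
  · exact add_zero _

instance : HasBinaryBiproducts (Pol k d) where
  has_binary_biproduct S T := hasBinaryBiproduct_of_total (bicone S T)
    (hom_ext fun e M x => bicone_total S T e M x)

end Pol

/-! ## Schur superfunctors -/

/-- The subgroup of the permutations of `{1, …, d}` that preserve the blocks (the fibres
of `b`). -/
def youngSubgroup (b : Fin d → ℕ) : Subgroup (Equiv.Perm (Fin d)) where
  carrier := {σ | ∀ i, b (σ i) = b i}
  mul_mem' {σ τ} hσ hτ i := by rw [Equiv.Perm.mul_apply, hσ, hτ]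
  one_mem' _ := rfl
  inv_mem' {σ} hσ i := by rw [← hσ (σ⁻¹ i)]; simp

/-- The span of all `x.σ - x` with `x ∈ M^{⊗d}` and `σ ∈ H`. -/
noncomputable def symRel (H : Subgroup (Equiv.Perm (Fin d))) (M : SVec k) :
    Submodule k (M.tpow d) :=
  Submodule.span k {y | ∃ σ ∈ H, ∃ x, superAct M σ x - x = y}

theorem proj_mem_symRel (H : Subgroup (Equiv.Perm (Fin d))) (M : SVec k) (e : ZMod 2)
    {x : M.tpow d} (hx : x ∈ symRel H M) : (M.tpow d).proj e x ∈ symRel H M := by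
  unfold symRel at hx
  induction hx using Submodule.span_induction with
  | mem x h =>
    obtain ⟨σ, hσ, x, rfl⟩ := h
    rw [map_sub, proj_comm (superAct_mem_homPart M σ)]
    exact Submodule.subset_span ⟨σ, hσ, _, rfl⟩
  | zero => rw [map_zero]; exact Submodule.zero_mem _
  | add x y _ _ hx hy => rw [map_add]; exact Submodule.add_mem _ hx hy
  | smul c x _ hx => rw [map_smul]; exact Submodule.smul_mem _ _ hx

/-- The coinvariants `(M^{⊗d})_H` as a superspace. For the Young subgroup `H = 𝔖_α` this is
`S^α(M) = S^{α₁}(M) ⊗ S^{α₂}(M) ⊗ ⋯`, and the quotient map is the multiplication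
`m : M^{⊗d} → S^α(M)`. -/
noncomputable abbrev symPow (H : Subgroup (Equiv.Perm (Fin d))) (M : SVec k) : SVec k where
  carrier := M.tpow d ⧸ symRel H M
  part e := ((M.tpow d).part e).map (symRel H M).mkQ
  isCompl := by
    constructor
    · rw [Submodule.disjoint_def]
      rintro _ ⟨a, ha, rfl⟩ ⟨b, hb, hab⟩
      have h1 : a - b ∈ symRel H M := by
        rw [← Submodule.ker_mkQ (symRel H M), LinearMap.mem_ker, map_sub, hab, sub_self]
      have h2 := proj_mem_symRel H M 0 h1
      rw [map_sub, (M.tpow d).proj_of_mem 0 ha, (M.tpow d).proj_of_mem_ne (by decide) hb,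
        sub_zero] at h2
      rwa [← LinearMap.mem_ker, Submodule.ker_mkQ]
    · rw [codisjoint_iff, ← Submodule.map_sup, (M.tpow d).isCompl.sup_eq_top,
        Submodule.map_top, Submodule.range_mkQ]

/-- The action of a morphism of `Γ^d_M` on the coinvariants. -/
noncomputable def symMap (H : Subgroup (Equiv.Perm (Fin d))) {M N : SVec k} (f : GammaHom d M N) :
    symPow H M →ₗ[k] symPow H N :=
  (symRel H M).mapQ (symRel H N) f.1 (by
    rw [symRel, Submodule.span_le]
    rintro _ ⟨σ, hσ, x, rfl⟩
    refine Submodule.subset_span ⟨σ, hσ, f.1 x, ?_⟩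
    rw [map_sub]
    exact congrArg (· - f.1 x) (LinearMap.congr_fun (f.2 σ trivial) x).symm)

/-- The cells of `lam` (row index, column index; both from `0`) listed row by row. -/
def rowReading (lam : YoungDiagram) (h : lam.card = d) : Fin d ≃ lam.cells :=
  ((lam.cells.map (toLex : ℕ × ℕ ≃ ℕ ×ₗ ℕ).toEmbedding).orderIsoOfFin
      ((Finset.card_map _).trans h)).toEquiv.trans
    ((toLex : ℕ × ℕ ≃ ℕ ×ₗ ℕ).subtypeEquiv (by simp)).symm

/-- The cells of `lam` listed column by column. -/
def colReading (lam : YoungDiagram) (h : lam.card = d) : Fin d ≃ lam.cells :=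
  ((lam.cells.map ((Equiv.prodComm ℕ ℕ).trans (toLex : ℕ × ℕ ≃ ℕ ×ₗ ℕ)).toEmbedding).orderIsoOfFin
      ((Finset.card_map _).trans h)).toEquiv.trans
    (((Equiv.prodComm ℕ ℕ).trans (toLex : ℕ × ℕ ≃ ℕ ×ₗ ℕ)).subtypeEquiv (by simp)).symm

/-- The permutation `σ_λ`: it sends the number of a cell in the row by row numbering to its
number in the column by column numbering. -/
def sigmaPerm (lam : YoungDiagram) (h : lam.card = d) : Equiv.Perm (Fin d) :=
  (rowReading lam h).trans (colReading lam h).symm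

/-- `𝔖_λ = 𝔖_{λ₁} × 𝔖_{λ₂} × ⋯`: the first `λ₁` numbers form the first block, and so on. -/
def rowGroup (lam : YoungDiagram) (h : lam.card = d) : Subgroup (Equiv.Perm (Fin d)) :=
  youngSubgroup fun r => (rowReading lam h r).1.1

/-- `𝔖_{λ'}` for the conjugate partition `λ'`: the first `λ'₁` numbers form the first block,
and so on. -/
def colGroup (lam : YoungDiagram) (h : lam.card = d) : Subgroup (Equiv.Perm (Fin d)) :=
  youngSubgroup fun r => (colReading lam h r).1.2

/-- `Γ_Π^{λ'}(M)`. Since `Γ_Π^n(M) = Hom_{Γ^n}(k^{0|1}, M) = Hom_{k𝔖_n}((k^{0|1})^{⊗n}, M^{⊗n})`,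
the tensor product over the parts `n` of `λ'` consists of the `𝔖_{λ'}`-equivariant maps
`(k^{0|1})^{⊗d} → M^{⊗d}`. -/
noncomputable abbrev gammaPi (lam : YoungDiagram) (h : lam.card = d) (M : SVec k) :
    Submodule k ((oddLine k).tpow d →ₗ[k] M.tpow d) :=
  equivHom (colGroup lam h) (oddLine k) M

/-- The canonical embedding `Δ_Π : Γ_Π^{λ'}(M) → M^{⊗d}`, the evaluation at the generator
`1 ⊗ ⋯ ⊗ 1` of `(k^{0|1})^{⊗d}`. -/
noncomputable def deltaPi (lam : YoungDiagram) (h : lam.card = d) (M : SVec k) :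
    gammaPi lam h M →ₗ[k] M.tpow d :=
  LinearMap.applyₗ (PiTensorProduct.tprod k fun _ : Fin d => (1 : k) : (oddLine k).tpow d) ∘ₗ
    (gammaPi lam h M).subtype

/-- The map `θ_λ(M) : Γ_Π^{λ'}(M) → M^{⊗d} → M^{⊗d} → S^λ(M)`. -/
noncomputable def theta (lam : YoungDiagram) (h : lam.card = d) (M : SVec k) :
    gammaPi lam h M →ₗ[k] symPow (rowGroup lam h) M :=
  (symRel (rowGroup lam h) M).mkQ ∘ₗ superAct M (sigmaPerm lam h) ∘ₗ deltaPi lam h M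

theorem proj_comp_mem (H : Subgroup (Equiv.Perm (Fin d))) {M N : SVec k} (e : ZMod 2)
    {f : M.tpow d →ₗ[k] N.tpow d} (hf : f ∈ equivHom H M N) :
    (N.tpow d).proj e ∘ₗ f ∈ equivHom H M N := by
  intro σ hσ
  rw [LinearMap.comp_assoc, hf σ hσ]
  exact LinearMap.ext fun x => proj_comm (superAct_mem_homPart N σ) e (f x)

theorem theta_proj_mem (lam : YoungDiagram) (h : lam.card = d) (M : SVec k) (e : ZMod 2)
    (f : gammaPi lam h M) :
    theta lam h M ⟨(M.tpow d).proj e ∘ₗ f.1, proj_comp_mem _ e f.2⟩ ∈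
      (symPow (rowGroup lam h) M).part e := by
  refine ⟨_, ?_, rfl⟩
  have := superAct_mem_homPart M (sigmaPerm lam h) e _ ((M.tpow d).proj_mem e (deltaPi lam h M f))
  rw [zero_add] at this
  exact this

theorem theta_natural (lam : YoungDiagram) (h : lam.card = d) {M N : SVec k}
    (f : GammaHom d M N) (g : gammaPi lam h M) :
    symMap (rowGroup lam h) f (theta lam h M g) =
      theta lam h N ⟨f.1 ∘ₗ g.1, comp_mem_equivHom (equivHom_mono le_top _ _ f.2) g.2⟩ :=
  congrArg (symRel (rowGroup lam h) N).mkQ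
    (LinearMap.congr_fun (f.2 (sigmaPerm lam h) trivial) (deltaPi lam h M g))

/-- The superspace `Ŝ_λ(M)`: the image of `θ_λ(M)`, a subsuperspace of `S^λ(M)`. -/
noncomputable abbrev schurObj (lam : YoungDiagram) (h : lam.card = d) (M : SVec k) : SVec k where
  carrier := LinearMap.range (theta lam h M)
  part e := ((symPow (rowGroup lam h) M).part e).comap (LinearMap.range (theta lam h M)).subtype
  isCompl := by
    constructor
    · rw [Submodule.disjoint_def]
      intro x h0 h1
      exact Subtype.ext (Submodule.disjoint_def.1
        (symPow (rowGroup lam h) M).isCompl.disjoint x.1 h0 h1)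
    · rw [codisjoint_iff, eq_top_iff]
      rintro ⟨_, f, rfl⟩ _
      refine Submodule.mem_sup.2
        ⟨⟨_, _, rfl⟩, theta_proj_mem lam h M 0 f, ⟨_, _, rfl⟩, theta_proj_mem lam h M 1 f, ?_⟩
      refine Subtype.ext ?_
      change theta lam h M _ + theta lam h M _ = theta lam h M f
      rw [← map_add]
      refine congrArg (theta lam h M) (Subtype.ext (LinearMap.ext fun x => ?_))
      exact (M.tpow d).proj_add (f.1 x)

/-- The Schur superfunctor `Ŝ_λ = Im θ_λ`, an object of `Pol^I_d`. -/
noncomputable def schur (k : Type u) [Field k] (lam : YoungDiagram) (h : lam.card = d) :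
    Pol k d where
  obj M := schurObj lam h M
  map {M N} :=
    { toFun := fun f => (symMap (rowGroup lam h) f).restrict (by
        rintro _ ⟨g, rfl⟩
        exact ⟨_, (theta_natural lam h f g).symm⟩)
      map_add' := fun f g => by
        refine LinearMap.ext fun ⟨x, hx⟩ => Subtype.ext ?_
        obtain ⟨x, rfl⟩ := Submodule.mkQ_surjective _ x
        rfl
      map_smul' := fun c f => by
        refine LinearMap.ext fun ⟨x, hx⟩ => Subtype.ext ?_
        obtain ⟨x, rfl⟩ := Submodule.mkQ_surjective _ x
        rfl }
  map_id M := by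
    refine LinearMap.ext fun ⟨x, hx⟩ => Subtype.ext ?_
    obtain ⟨x, rfl⟩ := Submodule.mkQ_surjective _ x
    rfl
  map_comp g f := by
    refine LinearMap.ext fun ⟨x, hx⟩ => Subtype.ext ?_
    obtain ⟨x, rfl⟩ := Submodule.mkQ_surjective _ x
    rfl
  map_even f e hf := by
    rintro δ ⟨_, hx⟩ ⟨x, hxδ, rfl⟩
    exact ⟨f.1 x, hf δ x hxδ, rfl⟩

end SuperPoly

/-!
The Schur superfunctor is generated by one homogeneous vector `v ∈ Ŝ_λ(k^{0|λ₁})`, the image of the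
word that labels every cell of `λ` by its column: a tensor in `M^{⊗d}` that transforms by the sign
under the column group is the image of this word under a morphism `k^{0|λ₁} → M` of `Γ^d`.

The words with the same letters span the image of an even idempotent `π` of `Γ^d End(k^{0|λ₁})`.
Among them, those with a repeated letter in a row of `λ` vanish in `S^λ(k^{0|λ₁})`, because
`2 ≠ 0` and odd vectors anticommute there. By counting, the others arise from the standard filling
by row permutations. So `π` fixes `v` and maps `Ŝ_λ(k^{0|λ₁})` onto the line `kv`.

By naturality with respect to `π`, both components of an endomorphism of `Ŝ_λ` map `v` into `kv`.
The odd one kills `v`, since `v` is homogeneous, and the even one multiplies it by a scalar. As `v`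
generates, an idempotent endomorphism is `0` or the identity.
-/

namespace SuperPoly

variable {k : Type u} [Field k] {d : ℕ}

/-! ## The signed action -/

theorem prod_prod_Ioi_comp_perm {A : Type*} [CommMonoid A] {g : Fin d → Fin d → A}
    (hg : ∀ i j, g i j = g j i) (σ : Equiv.Perm (Fin d)) :
    ∏ i, ∏ j ∈ Finset.Ioi i, g (σ i) (σ j) = ∏ i, ∏ j ∈ Finset.Ioi i, g i j := by
  let f : Fin d → Fin d → A := fun j i => if σ.symm i < σ.symm j then g i j else 1
  have hf : ∀ i, ∀ j ∈ Finset.Ioi i, f j i * f i j = g i j := fun i j hij => by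
    have hne : σ.symm i ≠ σ.symm j := σ.symm.injective.ne (Finset.mem_Ioi.1 hij).ne
    rcases hne.lt_or_gt with h | h <;> simp [f, h, h.not_gt, hg j i]
  calc ∏ i, ∏ j ∈ Finset.Ioi i, g (σ i) (σ j)
      = ∏ i, ∏ j, f (σ j) (σ i) := by
        simp only [f, Equiv.symm_apply_apply, ← Finset.prod_filter, Finset.filter_lt_eq_Ioi]
    _ = ∏ i, ∏ j, f j i := by
        rw [← Equiv.prod_comp σ fun i => ∏ j, f j i]
        exact Finset.prod_congr rfl fun i _ => Equiv.prod_comp σ fun j => f j (σ i)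
    _ = ∏ i, ∏ j ∈ {i}ᶜ, f j i := Finset.prod_congr rfl fun i _ => by
        refine (Finset.prod_subset (Finset.subset_univ _) fun j _ hj => ?_).symm
        obtain rfl : j = i := by simpa using hj
        exact if_neg (lt_irrefl _)
    _ = ∏ i, ∏ j ∈ Finset.Ioi i, g i j := by
        rw [← Finset.prod_prod_Ioi_mul_eq_prod_prod_off_diag f]
        exact Finset.prod_congr rfl fun i _ => Finset.prod_congr rfl (hf i)

theorem superSign_eq_prod_Ioi (a : Fin d → ZMod 2) (σ : Equiv.Perm (Fin d)) :
    superSign k a σ = ∏ i, ∏ j ∈ Finset.Ioi i,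
      if σ.symm j < σ.symm i then (-1 : k) ^ (a i * a j).val else 1 := by
  simp only [superSign, Fintype.prod_prod_type, ite_and, ← Finset.filter_lt_eq_Ioi,
    Finset.prod_filter]

theorem superSign_mul (a : Fin d → ZMod 2) (σ τ : Equiv.Perm (Fin d)) :
    superSign k a (σ * τ) = superSign k a σ * superSign k (a ∘ σ) τ := by
  -- `τ` inverts the `σ`-preimages of `i, j` iff exactly one of `σ` and `σ * τ` inverts `i, j`.
  let g : Fin d → Fin d → k := fun i j =>
    if σ.symm i < σ.symm j ↔ (σ * τ).symm j < (σ * τ).symm i then (-1) ^ (a i * a j).val else 1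
  have hne : ∀ {i j} (ρ : Equiv.Perm (Fin d)), i ≠ j → ρ.symm i ≠ ρ.symm j :=
    fun ρ => ρ.symm.injective.ne
  have hg : ∀ i j, g i j = g j i := fun i j => by
    rcases eq_or_ne i j with rfl | hij
    · rfl
    · have := hne σ hij
      have := hne (σ * τ) hij
      simp only [g, mul_comm (a j)]
      congr 1
      grind
  have hτ : superSign k (a ∘ σ) τ = ∏ i, ∏ j ∈ Finset.Ioi i, g i j := by
    rw [superSign_eq_prod_Ioi, ← prod_prod_Ioi_comp_perm hg σ]
    refine Finset.prod_congr rfl fun i _ => Finset.prod_congr rfl fun j hij => ?_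
    have hij := Finset.mem_Ioi.1 hij
    simp [g, Equiv.Perm.mul_def, hij]
  rw [hτ, superSign_eq_prod_Ioi, superSign_eq_prod_Ioi, ← Finset.prod_mul_distrib]
  refine Finset.prod_congr rfl fun i _ => ?_
  rw [← Finset.prod_mul_distrib]
  refine Finset.prod_congr rfl fun j hij => ?_
  have hsq : ((-1 : k) ^ (a i * a j).val) * (-1) ^ (a i * a j).val = 1 := by
    rw [← mul_pow]; simp
  have h := hne σ (Finset.mem_Ioi.1 hij).ne
  have h' := hne (σ * τ) (Finset.mem_Ioi.1 hij).ne
  rcases h.lt_or_gt with h | h <;> rcases h'.lt_or_gt with h' | h' <;>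
    simp [g, h, h', h.not_gt, h'.not_gt, hsq]

theorem tpow_linearMap_ext {M : SVec k} {V : Type*} [AddCommGroup V] [Module k V]
    {f g : M.tpow d →ₗ[k] V}
    (h : ∀ (a : Fin d → ZMod 2) (v : Fin d → M), (∀ i, v i ∈ M.part (a i)) →
      f (PiTensorProduct.tprod k v) = g (PiTensorProduct.tprod k v)) : f = g := by
  refine PiTensorProduct.ext (MultilinearMap.ext fun v => ?_)
  change f (PiTensorProduct.tprod k v) = g (PiTensorProduct.tprod k v)
  rw [← sum_map_proj M d (PiTensorProduct.tprod k v), map_sum, map_sum]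
  refine Finset.sum_congr rfl fun a _ => ?_
  rw [PiTensorProduct.map_tprod]
  exact h a _ fun i => M.proj_mem _ _

theorem superAct_mul (M : SVec k) (σ τ : Equiv.Perm (Fin d)) :
    superAct M (σ * τ) = superAct M τ ∘ₗ superAct M σ := by
  refine tpow_linearMap_ext fun a v hv => ?_
  rw [LinearMap.comp_apply, superAct_tprod M _ a v hv, superAct_tprod M σ a v hv, map_smul,
    superAct_tprod M τ (a ∘ σ) _ fun i => hv _, smul_smul, superSign_mul]
  rfl

/-- The sign character of the symmetric group, with values in `k`. -/
def signChar (k : Type u) [Field k] : Equiv.Perm (Fin d) →* k :=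
  ((Int.castRingHom k : ℤ →* k).comp (Units.coeHom ℤ)).comp Equiv.Perm.sign

theorem signChar_mul_self (σ : Equiv.Perm (Fin d)) : signChar k σ * signChar k σ = 1 := by
  rcases Int.units_eq_one_or (Equiv.Perm.sign σ) with h | h <;> simp [signChar, h]

theorem signChar_swap {i j : Fin d} (hij : i ≠ j) : signChar k (Equiv.swap i j) = -1 := by
  simp [signChar, Equiv.Perm.sign_swap hij]

theorem superSign_one (σ : Equiv.Perm (Fin d)) : superSign k (fun _ => 1) σ = signChar k σ := by
  have hval : ZMod.val (1 : ZMod 2) = 1 := rfl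
  change _ = ((Equiv.Perm.sign σ : ℤ) : k)
  rw [superSign_eq_prod_Ioi, ← Equiv.Perm.sign_symm, Equiv.Perm.sign_eq_prod_prod_Ioi]
  simp only [Units.coe_prod, Int.cast_prod]
  refine Finset.prod_congr rfl fun i _ => Finset.prod_congr rfl fun j hij => ?_
  have hne : σ.symm i ≠ σ.symm j := σ.symm.injective.ne (Finset.mem_Ioi.1 hij).ne
  rcases hne.lt_or_gt with h | h <;> simp [h, h.not_gt, hval]

theorem superAct_tprod_of_odd {M : SVec k} (hM : M.part 1 = ⊤) (σ : Equiv.Perm (Fin d))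
    (v : Fin d → M) :
    superAct M σ (PiTensorProduct.tprod k v) =
      signChar k σ • PiTensorProduct.tprod k (v ∘ σ) := by
  rw [superAct_tprod M σ _ v fun _ => hM.ge Submodule.mem_top, superSign_one]
  rfl

/-- The tensors on which every `σ ∈ H` acts as multiplication by its sign. -/
noncomputable def signIsotypic (H : Subgroup (Equiv.Perm (Fin d))) (M : SVec k) :
    Submodule k (M.tpow d) where
  carrier := {y | ∀ σ ∈ H, superAct M σ y = signChar k σ • y}
  add_mem' hx hy σ hσ := by rw [map_add, hx σ hσ, hy σ hσ, smul_add]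
  zero_mem' σ _ := by rw [map_zero, smul_zero]
  smul_mem' r _ hy σ hσ := by rw [map_smul, hy σ hσ, smul_comm]

theorem proj_mem_signIsotypic {H : Subgroup (Equiv.Perm (Fin d))} {M : SVec k} {y : M.tpow d}
    (hy : y ∈ signIsotypic H M) (e : ZMod 2) : (M.tpow d).proj e y ∈ signIsotypic H M :=
  fun σ hσ => by
    rw [← proj_comm (superAct_mem_homPart M σ), hy σ hσ, map_smul]

theorem range_deltaPi (lam : YoungDiagram) (h : lam.card = d) (M : SVec k) :
    LinearMap.range (deltaPi lam h M) = signIsotypic (colGroup lam h) M := by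
  have hodd := superAct_tprod_of_odd (d := d) (M := oddLine k) rfl
  let one : Fin d → oddLine k := fun _ => (1 : k)
  refine le_antisymm ?_ fun y hy => ?_
  · rintro _ ⟨f, rfl⟩ σ hσ
    have hf : f.1 (superAct (oddLine k) σ (PiTensorProduct.tprod k one)) =
        superAct M σ (deltaPi lam h M f) := LinearMap.congr_fun (f.2 σ hσ) _
    rw [hodd, map_smul] at hf
    exact hf.symm
  · let g : (oddLine k).tpow d →ₗ[k] M.tpow d :=
      PiTensorProduct.lift (MultilinearMap.mkPiRing k (Fin d) y)
    have hg : ∀ v : Fin d → k, g (PiTensorProduct.tprod k v) = (∏ i, v i) • y := fun v =>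
      (PiTensorProduct.lift.tprod _).trans (MultilinearMap.mkPiRing_apply _ _)
    refine ⟨⟨g, fun σ hσ => PiTensorProduct.ext (MultilinearMap.ext fun v => ?_)⟩, ?_⟩
    · have hinv : g (PiTensorProduct.tprod k (v ∘ σ)) = g (PiTensorProduct.tprod k v) :=
        (hg (v ∘ σ)).trans <| (congrArg (· • y) (Equiv.prod_comp (M := k) σ v)).trans (hg v).symm
      have hact : g (PiTensorProduct.tprod k v) ∈ signIsotypic (colGroup lam h) M :=
        (hg v).symm ▸ Submodule.smul_mem _ _ hy
      change g (superAct (oddLine k) σ (PiTensorProduct.tprod k v)) =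
        superAct M σ (g (PiTensorProduct.tprod k v))
      rw [hodd, map_smul, hinv, hact σ hσ]
    · exact (hg one).trans (by rw [Finset.prod_const_one, one_smul])

/-! ## Purely odd superspaces -/

theorem tpow_part_eq_top {M : SVec k} (hM : M.part 1 = ⊤) : (M.tpow d).part d = ⊤ := by
  rw [eq_top_iff, ← PiTensorProduct.span_tprod_eq_top]
  refine Submodule.span_mono ?_
  rintro _ ⟨v, rfl⟩
  exact ⟨fun _ => 1, v, by simp, fun i => hM.ge Submodule.mem_top, rfl⟩

theorem mem_homPart_of_part_eq_top {M N : SVec k} {e δ : ZMod 2} (hM : M.part δ = ⊤)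
    {f : M →ₗ[k] N} (hf : ∀ x, f x ∈ N.part e) : f ∈ homPart M N (e + δ) := by
  intro ε x hx
  by_cases hε : ε = δ
  · rw [hε, add_assoc, CharTwo.add_self_eq_zero, add_zero]
    exact hf x
  · have hx0 : x = 0 := by
      rw [← M.proj_of_mem_ne (Ne.symm hε) hx, M.proj_of_mem δ (hM.ge Submodule.mem_top)]
    rw [hx0, map_zero]
    exact Submodule.zero_mem _

/-- The purely odd superspace `k^{0|n}`. -/
def oddSpace (k : Type u) [Field k] (n : ℕ) : SVec k where
  carrier := Fin n → k
  part e := if e = 1 then ⊤ else ⊥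
  isCompl := by simpa using isCompl_bot_top

variable {n : ℕ}

theorem oddSpace_part_one : (oddSpace k n).part 1 = ⊤ := rfl

/-- The standard basis of `k^{0|n}`. -/
noncomputable def oddBasis (k : Type u) [Field k] (n : ℕ) : Module.Basis (Fin n) k (oddSpace k n) :=
  Pi.basisFun k (Fin n)

/-- The standard basis of `(k^{0|n})^{⊗d}`, indexed by words: `e_a = e_{a 1} ⊗ ⋯ ⊗ e_{a d}`. -/
noncomputable def tensorBasis (k : Type u) [Field k] (n d : ℕ) :
    Module.Basis (Fin d → Fin n) k ((oddSpace k n).tpow d) :=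
  Basis.piTensorProduct fun _ => oddBasis k n

theorem superAct_tensorBasis (σ : Equiv.Perm (Fin d)) (a : Fin d → Fin n) :
    superAct (oddSpace k n) σ (tensorBasis k n d a) =
      signChar k σ • tensorBasis k n d (a ∘ σ) := by
  rw [tensorBasis, Basis.piTensorProduct_apply, Basis.piTensorProduct_apply,
    superAct_tprod_of_odd oddSpace_part_one]
  rfl

/-- The permutations of the places that fix the word `c`. -/
abbrev wordStabilizer (c : Fin d → Fin n) : Subgroup (Equiv.Perm (Fin d)) :=
  youngSubgroup fun i => (c i : ℕ)

theorem mem_wordStabilizer_iff {c : Fin d → Fin n} {σ : Equiv.Perm (Fin d)} :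
    σ ∈ wordStabilizer c ↔ c ∘ σ = c := by
  simp only [funext_iff, Function.comp_apply, Fin.ext_iff]
  rfl

theorem tensorBasis_mem_signIsotypic (c : Fin d → Fin n) :
    tensorBasis k n d c ∈ signIsotypic (wordStabilizer c) (oddSpace k n) := fun σ hσ => by
  rw [superAct_tensorBasis, mem_wordStabilizer_iff.1 hσ]

/-! ## Morphisms of `Γ^d` out of a purely odd superspace -/

section Extend

variable {c : Fin d → Fin n} {M : SVec k} {y : M.tpow d}

open Classical in
/-- The linear map `(k^{0|n})^{⊗d} → M^{⊗d}` with `e_{c ∘ σ} ↦ sgn(σ) y.σ` that vanishes on the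
words which are not rearrangements of `c`. The choice of `σ` is immaterial when `y` transforms
by the sign under the stabilizer of `c`. -/
noncomputable def extendMap (c : Fin d → Fin n) (y : M.tpow d) :
    (oddSpace k n).tpow d →ₗ[k] M.tpow d :=
  (tensorBasis k n d).constr k fun a =>
    if h : ∃ σ : Equiv.Perm (Fin d), c ∘ σ = a then
      signChar k h.choose • superAct M h.choose y else 0

theorem extendMap_comp_perm (hy : y ∈ signIsotypic (wordStabilizer c) M)
    (σ : Equiv.Perm (Fin d)) :
    extendMap c y (tensorBasis k n d (c ∘ σ)) = signChar k σ • superAct M σ y := by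
  have h : ∃ τ : Equiv.Perm (Fin d), c ∘ τ = c ∘ σ := ⟨σ, rfl⟩
  rw [extendMap, Module.Basis.constr_basis, dif_pos h]
  obtain ⟨τ, hτ, hcτ⟩ : ∃ τ, h.choose = τ ∧ c ∘ τ = c ∘ σ := ⟨_, rfl, h.choose_spec⟩
  rw [hτ]
  obtain ⟨ρ, rfl⟩ : ∃ ρ, σ = ρ * τ := ⟨σ * τ⁻¹, (inv_mul_cancel_right σ τ).symm⟩
  have hρ : ρ ∈ wordStabilizer c := mem_wordStabilizer_iff.2 <|
    funext fun i => by simpa using (congrFun hcτ (τ⁻¹ i)).symm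
  rw [superAct_mul, LinearMap.comp_apply, hy ρ hρ, map_smul, smul_smul, map_mul, mul_right_comm,
    signChar_mul_self, one_mul]

theorem extendMap_eq_zero {a : Fin d → Fin n} (ha : ¬ ∃ σ : Equiv.Perm (Fin d), c ∘ σ = a) :
    extendMap c y (tensorBasis k n d a) = 0 := by
  rw [extendMap, Module.Basis.constr_basis, dif_neg ha]

theorem extendMap_mem_equivHom (hy : y ∈ signIsotypic (wordStabilizer c) M) :
    extendMap c y ∈ equivHom (⊤ : Subgroup (Equiv.Perm (Fin d))) (oddSpace k n) M := by
  intro τ _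
  refine (tensorBasis k n d).ext fun a => ?_
  rw [LinearMap.comp_apply, LinearMap.comp_apply, superAct_tensorBasis,
    map_smul]
  by_cases ha : ∃ σ : Equiv.Perm (Fin d), c ∘ σ = a
  · obtain ⟨σ, rfl⟩ := ha
    rw [Function.comp_assoc, ← Equiv.Perm.coe_mul, extendMap_comp_perm hy, extendMap_comp_perm hy,
      superAct_mul, map_smul, smul_smul, map_mul, mul_left_comm,
      signChar_mul_self, mul_one, LinearMap.comp_apply]
  · rw [extendMap_eq_zero ha, extendMap_eq_zero, map_zero, smul_zero]
    rintro ⟨σ, hσ⟩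
    exact ha ⟨σ * τ⁻¹, funext fun i => by simpa using congrFun hσ (τ⁻¹ i)⟩

/-- The morphism `k^{0|n} → M` of `Γ^d` with `e_c ↦ y` that vanishes on the words which are not
rearrangements of `c`. It exists when `y` transforms by the sign under the stabilizer of `c`. -/
noncomputable def extendHom (c : Fin d → Fin n) (y : M.tpow d)
    (hy : y ∈ signIsotypic (wordStabilizer c) M) : GammaHom d (oddSpace k n) M :=
  ⟨extendMap c y, extendMap_mem_equivHom hy⟩

theorem extendHom_tensorBasis_self (hy : y ∈ signIsotypic (wordStabilizer c) M) :
    (extendHom c y hy).1 (tensorBasis k n d c) = y := by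
  have h := extendMap_comp_perm hy 1
  rwa [hy 1 (one_mem _), map_one, one_smul, one_smul] at h

theorem extendHom_apply_mem (hy : y ∈ signIsotypic (wordStabilizer c) M)
    {P : Submodule k (M.tpow d)} (hP : ∀ σ, superAct M σ y ∈ P) (x : (oddSpace k n).tpow d) :
    (extendHom c y hy).1 x ∈ P := by
  suffices h : ⊤ ≤ P.comap (extendHom c y hy).1 from h Submodule.mem_top
  rw [← (tensorBasis k n d).span_eq, Submodule.span_le]
  rintro _ ⟨a, rfl⟩
  change extendMap c y _ ∈ P
  by_cases ha : ∃ σ : Equiv.Perm (Fin d), c ∘ σ = a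
  · obtain ⟨σ, rfl⟩ := ha
    rw [extendMap_comp_perm hy]
    exact P.smul_mem _ (hP σ)
  · rw [extendMap_eq_zero ha]
    exact P.zero_mem

theorem extendHom_isHomogeneous (hy : y ∈ signIsotypic (wordStabilizer c) M) {e : ZMod 2}
    (he : y ∈ (M.tpow d).part e) : (extendHom c y hy).IsHomogeneous (e + d) :=
  mem_homPart_of_part_eq_top (tpow_part_eq_top oddSpace_part_one) <|
    extendHom_apply_mem hy fun σ => by simpa using superAct_mem_homPart M σ e y he

end Extend

/-- The idempotent of `Γ^d End(k^{0|n})` that projects onto the span of the rearrangements of the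
word `c`, that is, onto its weight space. -/
noncomputable def weightProj (k : Type u) [Field k] (c : Fin d → Fin n) :
    GammaHom d (oddSpace k n) (oddSpace k n) :=
  extendHom c (tensorBasis k n d c) (tensorBasis_mem_signIsotypic c)

theorem weightProj_isHomogeneous (c : Fin d → Fin n) : (weightProj k c).IsHomogeneous 0 := by
  rw [← CharTwo.add_self_eq_zero (d : ZMod 2)]
  exact extendHom_isHomogeneous _ ((tpow_part_eq_top oddSpace_part_one).ge Submodule.mem_top)

theorem weightProj_apply_mem_span (c : Fin d → Fin n) (x : (oddSpace k n).tpow d) :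
    (weightProj k c).1 x ∈ Submodule.span k
      (Set.range fun σ : Equiv.Perm (Fin d) => tensorBasis k n d (c ∘ σ)) :=
  extendHom_apply_mem _ (fun σ => by
    rw [superAct_tensorBasis]
    exact Submodule.smul_mem _ _ (Submodule.subset_span ⟨σ, rfl⟩)) x

/-! ## Coinvariants -/

theorem swap_mem_youngSubgroup {b : Fin d → ℕ} {i j : Fin d} (hij : b i = b j) :
    Equiv.swap i j ∈ youngSubgroup b := fun l => by
  rw [Equiv.swap_apply_def]
  split_ifs with hi hj
  · rw [hi, hij]
  · rw [hj, hij]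
  · rfl

section Coinvariants

variable {H : Subgroup (Equiv.Perm (Fin d))}

theorem mkQ_superAct {σ : Equiv.Perm (Fin d)} (hσ : σ ∈ H) (M : SVec k) (x : M.tpow d) :
    (symRel H M).mkQ (superAct M σ x) = (symRel H M).mkQ x :=
  (Submodule.Quotient.eq _).2 (Submodule.subset_span ⟨σ, hσ, x, rfl⟩)

theorem symRel_le_ker_sum_superAct [Fintype H] {M : SVec k} {V : Type*} [AddCommGroup V]
    [Module k V] (φ : M.tpow d →ₗ[k] V) :
    symRel H M ≤ LinearMap.ker (∑ σ : H, φ ∘ₗ superAct M σ) := by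
  refine Submodule.span_le.2 ?_
  rintro _ ⟨τ, hτ, x, rfl⟩
  have hinv : ∑ σ : H, φ (superAct M σ (superAct M τ x)) = ∑ σ : H, φ (superAct M σ x) := by
    simp only [← LinearMap.comp_apply (superAct M _) (superAct M τ), ← superAct_mul]
    exact Equiv.sum_comp (Equiv.mulLeft (⟨τ, hτ⟩ : H)) fun σ : H => φ (superAct M σ.1 x)
  rw [SetLike.mem_coe, LinearMap.mem_ker, map_sub, sub_eq_zero, LinearMap.sum_apply,
    LinearMap.sum_apply]
  exact hinv

theorem mkQ_tensorBasis_comp {σ : Equiv.Perm (Fin d)} (hσ : σ ∈ H) (a : Fin d → Fin n) :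
    (symRel H (oddSpace k n)).mkQ (tensorBasis k n d (a ∘ σ)) =
      signChar k σ • (symRel H (oddSpace k n)).mkQ (tensorBasis k n d a) := by
  rw [← mkQ_superAct hσ _ (tensorBasis k n d a), superAct_tensorBasis, map_smul, smul_smul,
    signChar_mul_self, one_smul]

theorem mkQ_tensorBasis_eq_zero (hk : ringChar k ≠ 2) {i j : Fin d} (hij : i ≠ j)
    (hH : Equiv.swap i j ∈ H) {a : Fin d → Fin n} (ha : a i = a j) :
    (symRel H (oddSpace k n)).mkQ (tensorBasis k n d a) = 0 := by
  have hneg := mkQ_tensorBasis_comp (k := k) hH a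
  rw [mem_wordStabilizer_iff.1 (swap_mem_youngSubgroup (congrArg Fin.val ha)), signChar_swap hij,
    neg_one_smul, ← add_eq_zero_iff_eq_neg, ← two_smul k] at hneg
  exact (smul_eq_zero.1 hneg).resolve_left (Ring.two_ne_zero hk)

theorem mkQ_tensorBasis_ne_zero {b : Fin d → Fin n} (hb : H ⊓ wordStabilizer b = ⊥) :
    (symRel H (oddSpace k n)).mkQ (tensorBasis k n d b) ≠ 0 := by
  classical
  have hmem_iff : ∀ σ : H, b ∘ (σ : Equiv.Perm (Fin d)) = b ↔ σ = 1 := fun σ => by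
    rw [← mem_wordStabilizer_iff, ← OneMemClass.coe_eq_one, ← Subgroup.mem_bot, ← hb,
      Subgroup.mem_inf, and_iff_right σ.2]
  have hcoord : ∀ σ : H, (tensorBasis k n d).coord b (superAct _ σ (tensorBasis k n d b)) =
      if σ = 1 then 1 else 0 := fun σ => by
    rw [superAct_tensorBasis, map_smul, Module.Basis.coord_apply, Module.Basis.repr_self,
      Finsupp.single_apply]
    split_ifs with hσb hσ hσ
    · rw [hσ, Subgroup.coe_one, map_one, one_smul]
    · exact absurd ((hmem_iff σ).1 hσb) hσ
    · exact absurd ((hmem_iff σ).2 hσ) hσb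
    · exact smul_zero _
  intro h0
  have hsum := symRel_le_ker_sum_superAct ((tensorBasis k n d).coord b)
    ((Submodule.Quotient.mk_eq_zero _).1 h0)
  rw [LinearMap.mem_ker, LinearMap.sum_apply] at hsum
  simp only [LinearMap.comp_apply, hcoord, Finset.sum_ite_eq', Finset.mem_univ, if_true,
    one_ne_zero] at hsum

end Coinvariants

/-! ## Fillings of Young diagrams -/

theorem card_filter_snd_lt_le (S : Finset (ℕ × ℕ)) (m n : ℕ) :
    (S.filter fun c => c.2 < n ∧ c.1 = m).card ≤ min n (S.filter fun c => c.1 = m).card := by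
  refine le_min ?_ (Finset.card_le_card (Finset.monotone_filter_right S fun c _ hc => hc.2))
  refine (Finset.card_le_card_of_injOn Prod.snd (t := Finset.range n) (fun c hc => ?_)
    fun c hc c' hc' hcc' => ?_).trans_eq (Finset.card_range n)
  · exact Finset.mem_range.2 (Finset.mem_filter.1 hc).2.1
  · exact Prod.ext ((Finset.mem_filter.1 hc).2.2.trans (Finset.mem_filter.1 hc').2.2.symm) hcc'

theorem card_cells_filter_snd_lt (lam : YoungDiagram) (m n : ℕ) :
    (lam.cells.filter fun c => c.2 < n ∧ c.1 = m).card = min n (lam.rowLen m) := by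
  have hset : (lam.cells.filter fun c => c.2 < n ∧ c.1 = m) =
      {m} ×ˢ Finset.range (min n (lam.rowLen m)) := by
    ext ⟨i, j⟩
    simp only [Finset.mem_filter, YoungDiagram.mem_cells, YoungDiagram.mem_iff_lt_rowLen,
      Finset.mem_product, Finset.mem_singleton, Finset.mem_range, lt_min_iff]
    grind
  rw [hset, Finset.card_product, Finset.card_singleton, one_mul, Finset.card_range]

theorem card_filter_eq_of_map_eq {α β : Type*} {S T : Finset α} {f : α → β}
    (h : S.val.map f = T.val.map f) (p : β → Prop) [DecidablePred p] :
    (S.filter fun a => p (f a)).card = (T.filter fun a => p (f a)).card :=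
  (Multiset.countP_map f S.val p).symm.trans
    ((congrArg (Multiset.countP p) h).trans (Multiset.countP_map f T.val p))

theorem eq_cells_of_map_fst_eq_of_map_snd_eq {lam : YoungDiagram} {S : Finset (ℕ × ℕ)}
    (hfst : S.val.map Prod.fst = lam.cells.val.map Prod.fst)
    (hsnd : S.val.map Prod.snd = lam.cells.val.map Prod.snd) : S = lam.cells := by
  have hrow : ∀ m, (S.filter fun c => c.1 = m).card = lam.rowLen m := fun m =>
    (card_filter_eq_of_map_eq hfst (· = m)).trans lam.rowLen_eq_card.symm
  -- In each row of `lam`, as many cells as possible lie in the first `n` columns.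
  have hle : ∀ m n, (S.filter fun c => c.2 < n ∧ c.1 = m).card ≤
      (lam.cells.filter fun c => c.2 < n ∧ c.1 = m).card := fun m n => by
    rw [card_cells_filter_snd_lt, ← hrow]
    exact card_filter_snd_lt_le S m n
  have hmaps : ∀ (T : Finset (ℕ × ℕ)), T.val.map Prod.fst = S.val.map Prod.fst → ∀ n,
      ∀ c ∈ T.filter fun c => c.2 < n, c.1 ∈ S.image Prod.fst := fun T hT n c hc => by
    have hmem := Multiset.mem_map_of_mem Prod.fst (Finset.mem_filter.1 hc).1
    exact Finset.mem_image.2 (Multiset.mem_map.1 (hT ▸ hmem))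
  have heq : ∀ n, ∀ m ∈ S.image Prod.fst, (S.filter fun c => c.2 < n ∧ c.1 = m).card =
      (lam.cells.filter fun c => c.2 < n ∧ c.1 = m).card := fun n => by
    rw [← Finset.sum_eq_sum_iff_of_le fun m _ => hle m n]
    simp only [← Finset.filter_filter]
    rw [← Finset.card_eq_sum_card_fiberwise (hmaps S rfl n),
      ← Finset.card_eq_sum_card_fiberwise (hmaps _ hfst.symm n)]
    exact card_filter_eq_of_map_eq hsnd (· < n)
  refine Finset.eq_of_subset_of_card_le (fun c hc => ?_) ?_
  · have hcard : (S.filter fun a => a.2 < lam.rowLen c.1 ∧ a.1 = c.1).card =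
        (S.filter fun a => a.1 = c.1).card := by
      rw [heq _ _ (Finset.mem_image_of_mem _ hc), card_cells_filter_snd_lt, min_self, hrow]
    have hfilter := Finset.eq_of_subset_of_card_le
      (Finset.monotone_filter_right S fun a _ ha => ha.2) hcard.ge
    have hc' : c ∈ S.filter fun a => a.1 = c.1 := Finset.mem_filter.2 ⟨hc, rfl⟩
    exact YoungDiagram.mem_iff_lt_rowLen.2 (Finset.mem_filter.1 (hfilter ▸ hc')).2.1
  · simpa using (congrArg Multiset.card hfst).ge

section Words

variable (lam : YoungDiagram) (h : lam.card = d)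

/-- The word formed by the columns of the cells, listed column by column. -/
def colWord (i : Fin d) : Fin (lam.rowLen 0) :=
  ⟨(colReading lam h i).1.2, (YoungDiagram.mem_iff_lt_rowLen.1 (colReading lam h i).2).trans_le
    (lam.rowLen_anti 0 _ (Nat.zero_le _))⟩

/-- The word formed by the columns of the cells, listed row by row. -/
def rowWord (i : Fin d) : Fin (lam.rowLen 0) :=
  ⟨(rowReading lam h i).1.2, (YoungDiagram.mem_iff_lt_rowLen.1 (rowReading lam h i).2).trans_le
    (lam.rowLen_anti 0 _ (Nat.zero_le _))⟩

theorem colWord_comp_sigmaPerm : colWord lam h ∘ sigmaPerm lam h = rowWord lam h :=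
  funext fun i => by simp [colWord, rowWord, sigmaPerm]

theorem rowGroup_inf_wordStabilizer_rowWord :
    rowGroup lam h ⊓ wordStabilizer (rowWord lam h) = ⊥ :=
  eq_bot_iff.2 fun _ ⟨hrow, hcol⟩ => Subgroup.mem_bot.2 <| Equiv.ext fun i =>
    (rowReading lam h).injective <| Subtype.ext <| Prod.ext (hrow i) (hcol i)

theorem map_rowReading_univ :
    (Finset.univ : Finset (Fin d)).val.map (fun i => (rowReading lam h i).1) = lam.cells.val := by
  refine (Multiset.map_map Subtype.val (rowReading lam h) _).symm.trans ?_
  rw [Multiset.map_univ_val_equiv, Finset.univ_eq_attach, Finset.attach_val,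
    Multiset.attach_map_val]

theorem exists_mem_rowGroup_rowWord_comp_eq {ρ : Equiv.Perm (Fin d)}
    (hinj : ∀ i j, (rowReading lam h i).1.1 = (rowReading lam h j).1.1 →
      rowWord lam h (ρ i) = rowWord lam h (ρ j) → i = j) :
    ∃ τ ∈ rowGroup lam h, rowWord lam h ∘ ρ = rowWord lam h ∘ τ := by
  -- Each cell stays in its row and receives the column index that `ρ` assigns to its place.
  let cell : Fin d ↪ ℕ × ℕ :=
    ⟨fun i => ((rowReading lam h i).1.1, (rowReading lam h (ρ i)).1.2), fun i j hij =>
      hinj i j (Prod.mk.inj hij).1 (Fin.ext (Prod.mk.inj hij).2)⟩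
  have hcells : Finset.univ.map cell = lam.cells := by
    apply eq_cells_of_map_fst_eq_of_map_snd_eq
    · rw [← map_rowReading_univ lam h, Finset.map_val, Multiset.map_map, Multiset.map_map]
      rfl
    · rw [← map_rowReading_univ lam h, Finset.map_val, Multiset.map_map, Multiset.map_map]
      conv_rhs => rw [← Multiset.map_univ_val_equiv ρ, Multiset.map_map]
      rfl
  let t : Fin d → Fin d := fun i =>
    (rowReading lam h).symm ⟨cell i, hcells ▸ Finset.mem_map_of_mem cell (Finset.mem_univ i)⟩
  have ht : ∀ i, (rowReading lam h (t i)).1 = cell i := fun i => by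
    rw [Equiv.apply_symm_apply]
  have htinj : Function.Injective t := fun i j hij => cell.injective (by rw [← ht, ← ht, hij])
  refine ⟨Equiv.ofBijective t (Finite.injective_iff_bijective.1 htinj), fun i => ?_,
    funext fun i => Fin.ext ?_⟩
  · exact (Prod.ext_iff.1 (ht i)).1
  · exact (Prod.ext_iff.1 (ht i)).2.symm

theorem mkQ_tensorBasis_rowWord_comp_mem_span (hk : ringChar k ≠ 2) (ρ : Equiv.Perm (Fin d)) :
    (symRel (rowGroup lam h) (oddSpace k _)).mkQ (tensorBasis k _ d (rowWord lam h ∘ ρ)) ∈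
      Submodule.span k
        {(symRel (rowGroup lam h) (oddSpace k _)).mkQ (tensorBasis k _ d (rowWord lam h))} := by
  by_cases hinj : ∀ i j, (rowReading lam h i).1.1 = (rowReading lam h j).1.1 →
      rowWord lam h (ρ i) = rowWord lam h (ρ j) → i = j
  · obtain ⟨τ, hτ, hρτ⟩ := exists_mem_rowGroup_rowWord_comp_eq lam h hinj
    rw [hρτ, mkQ_tensorBasis_comp hτ]
    exact Submodule.smul_mem _ _ (Submodule.mem_span_singleton_self _)
  · push Not at hinj
    obtain ⟨i, j, hrow, hcol, hij⟩ := hinj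
    have hswap : Equiv.swap i j ∈ rowGroup lam h := swap_mem_youngSubgroup hrow
    rw [mkQ_tensorBasis_eq_zero (a := rowWord lam h ∘ ρ) hk hij hswap hcol]
    exact Submodule.zero_mem _

end Words

/-! ## Indecomposability from a generator -/

theorem indecomposable_of_idem {C : Type*} [Category* C] [Preadditive C] [HasBinaryBiproducts C]
    {X : C} (hX : ¬ IsZero X) (hidem : ∀ p : X ⟶ X, p ≫ p = p → p = 0 ∨ p = 𝟙 X) :
    Indecomposable X := by
  refine ⟨hX, fun Y Z i => ?_⟩
  rcases hidem (i.hom ≫ biprod.fst ≫ biprod.inl ≫ i.inv) (by simp) with hp | hp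
  · refine Or.inl ((IsZero.iff_id_eq_zero Y).2 ?_)
    calc 𝟙 Y = biprod.inl ≫ i.inv ≫ (i.hom ≫ biprod.fst ≫ biprod.inl ≫ i.inv) ≫ i.hom ≫
        biprod.fst := by simp
      _ = 0 := by rw [hp]; simp
  · refine Or.inr ((IsZero.iff_id_eq_zero Z).2 ?_)
    calc 𝟙 Z = biprod.inr ≫ i.inv ≫ 𝟙 X ≫ i.hom ≫ biprod.snd := by simp
      _ = 0 := by rw [← hp]; simp

namespace Pol

/-- The vector `v` of `S(M)` generates `S`: for every `N`, the vectors `S(f) v` span `S(N)`. Here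
`f : M → N` runs over the homogeneous morphisms, for which alone naturality is formulated. -/
def IsGenerator (S : Pol k d) {M : SVec k} (v : S.obj M) : Prop :=
  ∀ N, Submodule.span k {x | ∃ (e : ZMod 2) (f : GammaHom d M N), f.IsHomogeneous e ∧
    S.map f v = x} = ⊤

section Generator

variable {S : Pol k d} {M : SVec k} {v : S.obj M}

theorem hom_ext_of_isGenerator {T : Pol k d} (hv : IsGenerator S v) {η θ : S ⟶ T}
    (h : ∀ e, Hom.app η e M v = Hom.app θ e M v) : η = θ := by
  refine hom_ext fun e N x => LinearMap.congr_fun (LinearMap.ext_on (hv N) ?_) x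
  rintro _ ⟨δ, f, hf, rfl⟩
  have hη := Hom.natural_apply η e δ f hf v
  rw [h, Hom.natural_apply θ e δ f hf v] at hη
  exact (smul_right_injective _ (pow_ne_zero _ (neg_ne_zero.2 one_ne_zero)) hη).symm

theorem not_isZero_of_ne_zero (hv0 : v ≠ 0) : ¬ IsZero S := fun hS => by
  have hid : Hom.app (Hom.id S) 0 M v = 0 :=
    congrArg (fun p : Hom S S => p.app 0 M v) (hS.eq_of_src (𝟙 S) 0)
  rw [id_app, if_pos rfl] at hid
  exact hv0 hid

variable {f : GammaHom d M M}

theorem app_mem_span_singleton (hf : f.IsHomogeneous 0) (hfv : S.map f v = v)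
    (hfspan : ∀ x, S.map f x ∈ Submodule.span k {v}) (η : Hom S S) (e : ZMod 2) :
    η.app e M v ∈ Submodule.span k {v} := by
  have hnat := η.natural_apply e 0 f hf v
  rw [hfv, zero_mul, ZMod.val_zero, pow_zero, one_smul] at hnat
  exact hnat ▸ hfspan _

theorem app_one_eq_zero {e : ZMod 2} (hve : v ∈ (S.obj M).part e) (η : Hom S S)
    (hη : η.app 1 M v ∈ Submodule.span k {v}) : η.app 1 M v = 0 := by
  refine Submodule.disjoint_def.1 ((S.obj M).isCompl_part e).disjoint _ ?_ ?_
  · exact (Submodule.span_singleton_le_iff_mem _ _).2 hve hη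
  · exact add_comm 1 e ▸ η.homogeneous 1 M e v hve

theorem eq_zero_or_eq_id_of_idem (hv : IsGenerator S v) (hv0 : v ≠ 0) {e : ZMod 2}
    (hve : v ∈ (S.obj M).part e) (hf : f.IsHomogeneous 0) (hfv : S.map f v = v)
    (hfspan : ∀ x, S.map f x ∈ Submodule.span k {v}) {p : S ⟶ S} (hp : p ≫ p = p) :
    p = 0 ∨ p = 𝟙 S := by
  have hspan := app_mem_span_singleton hf hfv hfspan p
  obtain ⟨r, hr⟩ := Submodule.mem_span_singleton.1 (hspan 0)
  have hp1 : Hom.app p 1 M v = 0 := app_one_eq_zero hve p (hspan 1)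
  have hrr : r * r = r := by
    have hpp : (Hom.comp p p).app 0 M v = Hom.app p 0 M v :=
      congrArg (fun q : Hom S S => q.app 0 M v) hp
    have hcomp : (Hom.comp p p).app 0 M v = (r * r) • v := by
      simp [Hom.comp, sum_zmod_two, ← hr, hp1, mul_smul]
    exact smul_left_injective k hv0 (hcomp.symm.trans (hpp.trans hr.symm))
  rcases IsIdempotentElem.iff_eq_zero_or_one.1 hrr with rfl | rfl
  · refine Or.inl (hom_ext_of_isGenerator hv fun e => ?_)
    rcases zmod_two_cases e with rfl | rfl
    · exact hr.symm.trans (zero_smul k v)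
    · exact hp1
  · refine Or.inr (hom_ext_of_isGenerator hv fun e => Eq.trans ?_ (id_app S e M v).symm)
    rcases zmod_two_cases e with rfl | rfl
    · exact hr.symm.trans (one_smul k v)
    · exact hp1

theorem indecomposable_of_isGenerator (hv : IsGenerator S v) (hv0 : v ≠ 0) {e : ZMod 2}
    (hve : v ∈ (S.obj M).part e) (hf : f.IsHomogeneous 0) (hfv : S.map f v = v)
    (hfspan : ∀ x, S.map f x ∈ Submodule.span k {v}) : Indecomposable S :=
  indecomposable_of_idem (not_isZero_of_ne_zero hv0) fun _ hp =>
    eq_zero_or_eq_id_of_idem hv hv0 hve hf hfv hfspan hp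

end Generator

end Pol

/-! ## The generator of a Schur superfunctor -/

section SchurGen

/-- The image in `Ŝ_λ(k^{0|λ₁})` of the tensor product of the basis vectors `e_j`, one for each
cell, where `j` is the column of the cell. -/
noncomputable def schurGen (k : Type u) [Field k] (lam : YoungDiagram) (h : lam.card = d) :
    (schur k lam h).obj (oddSpace k (lam.rowLen 0)) :=
  ⟨(symRel (rowGroup lam h) _).mkQ
      (superAct _ (sigmaPerm lam h) (tensorBasis k _ d (colWord lam h))), by
    rw [theta, ← LinearMap.comp_assoc, LinearMap.range_comp, range_deltaPi]
    exact Submodule.mem_map_of_mem (tensorBasis_mem_signIsotypic (colWord lam h))⟩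

variable (lam : YoungDiagram) (h : lam.card = d)

theorem coe_schurGen : (schurGen k lam h).1 = signChar k (sigmaPerm lam h) •
    (symRel (rowGroup lam h) _).mkQ (tensorBasis k _ d (rowWord lam h)) := by
  rw [← colWord_comp_sigmaPerm, ← map_smul, ← superAct_tensorBasis]
  rfl

theorem coe_map_schurGen {M : SVec k} (f : GammaHom d (oddSpace k (lam.rowLen 0)) M) :
    ((schur k lam h).map f (schurGen k lam h)).1 = (symRel (rowGroup lam h) M).mkQ
      (superAct M (sigmaPerm lam h) (f.1 (tensorBasis k _ d (colWord lam h)))) :=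
  congrArg (symRel (rowGroup lam h) M).mkQ (LinearMap.congr_fun (f.2 (sigmaPerm lam h) trivial) _)

theorem schurGen_ne_zero : schurGen k lam h ≠ 0 := fun h0 => by
  have hcoe := (coe_schurGen (k := k) lam h).symm.trans (congrArg Subtype.val h0)
  have hsign : signChar k (sigmaPerm lam h) ≠ 0 :=
    left_ne_zero_of_mul_eq_one (signChar_mul_self _)
  exact mkQ_tensorBasis_ne_zero (rowGroup_inf_wordStabilizer_rowWord lam h)
    ((smul_eq_zero.1 hcoe).resolve_left hsign)

theorem schurGen_mem_part : schurGen k lam h ∈ ((schur k lam h).obj (oddSpace k _)).part d :=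
  ⟨_, (tpow_part_eq_top oddSpace_part_one).ge Submodule.mem_top, rfl⟩

theorem map_weightProj_schurGen :
    (schur k lam h).map (weightProj k (colWord lam h)) (schurGen k lam h) = schurGen k lam h := by
  refine Subtype.ext ?_
  rw [coe_map_schurGen, weightProj, extendHom_tensorBasis_self]
  rfl

theorem map_weightProj_mem_span (hk : ringChar k ≠ 2)
    (x : (schur k lam h).obj (oddSpace k (lam.rowLen 0))) :
    (schur k lam h).map (weightProj k (colWord lam h)) x ∈
      Submodule.span k {schurGen k lam h} := by
  obtain ⟨x, hx⟩ := x
  obtain ⟨y, rfl⟩ := Submodule.mkQ_surjective _ x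
  have hle : Submodule.span k (Set.range fun σ : Equiv.Perm (Fin d) =>
      tensorBasis k _ d (colWord lam h ∘ σ)) ≤
      (Submodule.span k {(schurGen k lam h).1}).comap (symRel (rowGroup lam h) _).mkQ := by
    refine Submodule.span_le.2 ?_
    rintro _ ⟨σ, rfl⟩
    change (symRel (rowGroup lam h) _).mkQ (tensorBasis k _ d (colWord lam h ∘ σ)) ∈
      Submodule.span k {(schurGen k lam h).1}
    have hσ : colWord lam h ∘ σ = rowWord lam h ∘ ((sigmaPerm lam h)⁻¹ * σ : Equiv.Perm _) := by
      rw [← colWord_comp_sigmaPerm, Function.comp_assoc, ← Equiv.Perm.coe_mul, mul_inv_cancel_left]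
    rw [coe_schurGen, Submodule.span_singleton_smul_eq
      (IsUnit.of_mul_eq_one _ (signChar_mul_self _)), hσ]
    exact mkQ_tensorBasis_rowWord_comp_mem_span lam h hk _
  obtain ⟨r, hr⟩ := Submodule.mem_span_singleton.1 (hle (weightProj_apply_mem_span _ y))
  exact Submodule.mem_span_singleton.2 ⟨r, Subtype.ext hr⟩

theorem isGenerator_schurGen : (schur k lam h).IsGenerator (schurGen k lam h) := by
  refine fun N => eq_top_iff.2 ?_
  rintro ⟨_, f, rfl⟩ -
  have hy : deltaPi lam h N f ∈ signIsotypic (wordStabilizer (colWord lam h)) N :=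
    (range_deltaPi lam h N).le ⟨f, rfl⟩
  let F (e : ZMod 2) := extendHom _ _ (proj_mem_signIsotypic hy e)
  have hF : ∀ e, (F e).IsHomogeneous (e + d) := fun e =>
    extendHom_isHomogeneous _ ((N.tpow d).proj_mem e _)
  have hsum : (⟨theta lam h N f, f, rfl⟩ : (schur k lam h).obj N) =
      (schur k lam h).map (F 0) (schurGen k lam h) +
        (schur k lam h).map (F 1) (schurGen k lam h) := by
    refine Subtype.ext (Eq.trans ?_ (Submodule.coe_add _ _).symm)
    rw [coe_map_schurGen, coe_map_schurGen, extendHom_tensorBasis_self,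
      extendHom_tensorBasis_self, ← map_add, ← map_add, SVec.proj_add]
    rfl
  rw [hsum]
  exact Submodule.add_mem _ (Submodule.subset_span ⟨_, F 0, hF 0, rfl⟩)
    (Submodule.subset_span ⟨_, F 1, hF 1, rfl⟩)

end SchurGen

end SuperPoly

theorem mainTheorem3 (k : Type u) [Field k] (hk : ringChar k ≠ 2) (d : ℕ)
    (lam : YoungDiagram) (h : lam.card = d) :
    CategoryTheory.Indecomposable (SuperPoly.schur k lam h) := by
  exact SuperPoly.Pol.indecomposable_of_isGenerator (SuperPoly.isGenerator_schurGen lam h)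
    (SuperPoly.schurGen_ne_zero lam h) (SuperPoly.schurGen_mem_part lam h)
    (SuperPoly.weightProj_isHomogeneous _) (SuperPoly.map_weightProj_schurGen lam h)
    (SuperPoly.map_weightProj_mem_span lam h hk)
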